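/- Let $d\ge 1$, let $\mu$ be a probability measure on $\mathbb R$, put $\Omega=\{\omega\in\mathbb R^{\mathbb Z^d}:\omega_k\in\operatorname{supp}\mu\ \forall k\}$ and $\mathbb P=\bigotimes_{k\in\mathbb Z^d}\mu$. For $u\in\ell^1(\mathbb Z^d;\mathbb R)$ consider the discrete alloy-type model on $\ell^2(\mathbb Z^d)$, $$(h_\omega\psi)(x)=\sum_{\|x-y\|_1=1}(\psi(x)-\psi(y))+\Big(\sum_{k\in\mathbb Z^d}\omega_k u(x-k)\Big)\psi(x).$$ **Notation.** For $z\in\mathbb Z^d$ and $l\in\mathbb N$ let $\mathfrak C_l(z)=([-l,l]^d+z)\cap\mathbb Z^d$, let $h_\omega^{\mathfrak C}=\pi_{\mathfrak C}h_\omega\iota_{\mathfrak C}$ be the restriction of $h_\omega$ to a finite set $\mathfrak C\subset\mathbb Z^d$ (extend by zero, apply $h_\omega$, restrict), and let $\partial^{\rm i}\mathfrak C$ be the set of points of $\mathfrak C$ with fewer than $2d$ nearest neighbours (in $\ell^1$-distance $1$) in $\mathfrak C$. For $m>0$, $E\in\mathbb R$, the cube $\mathfrak C=\mathfrak C_l(z)$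 is *$(m,E)$-regular* for $\omega$ if $E\notin\sigma(h_\omega^{\mathfrak C})$ and $|\langle\delta_z,(h_\omega^{\mathfrak C}-E)^{-1}\delta_w\rangle|\le \mathrm e^{-ml}$ for all $w\in\partial^{\rm i}\mathfrak C$. It is *uniformly $(m,E)$-regular* for $\omega\in\Omega$ if it is $(m,E)$-regular for every $\omega'\in\Omega$ that coincides with $\omega$ on $\mathfrak C_{4l}(z)$. The estimate $G(I,l,m,\xi)$ holds if for all $z_1,z_2\in\mathbb Z^d$ with $\|z_1-z_2\|_\infty>8l$ the set of $\omega\in\Omega$ for which there is $E\in I$ such that neither $\mathfrak C_l(z_1)$ nor $\mathfrak C_l(z_2)$ is uniformly $(m,E)$-regular has (outer) $\mathbb P$-measure at most $l^{-2\xi}$. Let $\xi>2d$, $\kappa\in(1,2\xi/(\xi+2d))$, $\beta\in(2-\kappa,1)$, $q\in(0,1)$, and let $l^*\in\mathbb R$. We say that the *uniform initial scale estimate with parameters $\xi,\kappa,\beta,q$ and threshold $l^*$ holds in $I\subset\mathbb R$* if there are $m_0>0$ and an integer $l_0>1$ with $$l_0\ge l^*,\qquad l_0\ge\Big(\frac{(1-q)m_0}{(1-q)m_0+m_0+1}\Big)^{-\kappa/(1-\beta)},\qquad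 m_0>l_0^{\beta-1},$$ such that $G(I,l_0,m_0,\xi)$ holds. (In the multiscale analysis $l^*$ is the length scale from which on its induction step is valid; here it is an arbitrary number.) We say that *$u$ has negative part of size $\delta>0$* if $u=u_+-\delta u_-$ with $u_\pm\in\ell^1(\mathbb Z^d;[0,\infty))$, $\|u_-\|_1\le1$, and $\operatorname{supp}\mu=[0,\omega_+]$ for some $\omega_+>0$. **Proposition.** Assume $\mathbb P(\omega_0<\epsilon_0)\le\frac1{12}$ for some $\epsilon_0>0$. Let $C,\alpha,\overline u>0$, let $\xi,\kappa,\beta,q,l^*$ be as above, and let $\zeta\in(2-2(1-\beta)/\kappa,2)$. Then there exist $\delta>0$ and $\epsilon_{l_0}>0$, depending only on these data and on $d$, $\mu$, $\epsilon_0$ (on $u$ only through $C,\alpha,\overline u$), such that the following holds for every $u:\mathbb Z^d\to\mathbb R$ with $|u(k)|\le C\mathrm e^{-\alpha\|k\|_1}$ for all $k\in\mathbb Z^d$ and $\sum_{k\in\mathbb Z^d}u(k)=\overline u$: if $u$ has negative part of size $\delta$, then the uniform initial scale estimate with parameters $\xi,\kappa,\beta,q$ and threshold $l^*$ holds in $[-\epsilon_{l_0}/2,\epsilon_{l_0}/2]$.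 -/

import Mathlib

open MeasureTheory

noncomputable section

namespace AlloyModel

/-- The lattice `ℤ^d`. Its norm as a (finite) product of copies of `ℤ` is the sup norm. -/
abbrev Lattice (d : ℕ) : Type := Fin d → ℤ

/-- The `ℓ¹`-norm on `ℤ^d`. -/
def l1Norm {d : ℕ} (k : Lattice d) : ℤ := ∑ i, |k i|

/-- The cube `([-l, l]^d + z) ∩ ℤ^d`, for integer `l`. -/
def box {d : ℕ} (z : Lattice d) (l : ℕ) : Finset (Lattice d) :=
  Finset.Icc (fun i => z i - (l : ℤ)) (fun i => z i + (l : ℤ))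

theorem center_mem_box {d : ℕ} (z : Lattice d) (l : ℕ) : z ∈ box z l := by
  rw [box, Finset.mem_Icc]
  constructor <;> intro i <;> simp

/-- The lattice points at `ℓ¹`-distance one from `x`
(they all lie in the cube of radius one around `x`). -/
def neighbors {d : ℕ} (x : Lattice d) : Finset (Lattice d) :=
  (box x 1).filter (fun y => l1Norm (x - y) = 1)

/-- The interior boundary: points of `Q` with fewer than `2d` neighbors in `Q`. -/
def innerBoundary {d : ℕ} (Q : Finset (Lattice d)) : Finset (Lattice d) :=
  Q.filter (fun k => (Q.filter (fun j => l1Norm (k - j) = 1)).card < 2 * d)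

/-- The alloy-type potential `v_ω(x) = ∑_k ω_k u(x - k)`. -/
def potential {d : ℕ} (u ω : Lattice d → ℝ) (x : Lattice d) : ℝ :=
  ∑' k, ω k * u (x - k)

/-- The discrete alloy-type Schrödinger operator `h_ω = h_0 + v_ω`, acting on functions on `ℤ^d`,
where `(h_0 ψ)(x) = ∑_{‖x - y‖₁ = 1} (ψ(x) - ψ(y))`. -/
def hamiltonian {d : ℕ} (u ω : Lattice d → ℝ) (ψ : Lattice d → ℝ) (x : Lattice d) : ℝ :=
  (∑ y ∈ neighbors x, (ψ x - ψ y)) + potential u ω x * ψ x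

/-- The restriction of `h_ω` to a finite set `Q` (extend by zero, apply `h_ω`, restrict to `Q`), as
a matrix: its `(x, y)` entry is `⟨δ_x, h_ω δ_y⟩`. -/
def boxHamiltonian {d : ℕ} (u ω : Lattice d → ℝ) (Q : Finset (Lattice d)) : Matrix Q Q ℝ :=
  Matrix.of fun x y => hamiltonian u ω (Pi.single (y : Lattice d) 1) x

/-- The Green's function `⟨δ_x, (h_ω^Q - E)⁻¹ δ_y⟩`, for `E` outside the spectrum. -/
def green {d : ℕ} (u ω : Lattice d → ℝ) (Q : Finset (Lattice d)) (E : ℝ) (x y : Q) : ℝ :=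
  (boxHamiltonian u ω Q - E • (1 : Matrix Q Q ℝ))⁻¹ x y

/-- The cube of radius `l` around `z` is `(m, E)`-regular for `ω`. -/
def IsRegular {d : ℕ} (u : Lattice d → ℝ) (z : Lattice d) (l : ℕ) (m E : ℝ)
    (ω : Lattice d → ℝ) : Prop :=
  E ∉ spectrum ℝ (boxHamiltonian u ω (box z l)) ∧
    ∀ w : box z l, (w : Lattice d) ∈ innerBoundary (box z l) →
      |green u ω (box z l) E ⟨z, center_mem_box z l⟩ w| ≤ Real.exp (-m * l)

/-- The space of configurations: all coupling constants lie in the support of `μ`. -/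
def configurations (d : ℕ) (μ : Measure ℝ) : Set (Lattice d → ℝ) :=
  {ω | ∀ k, ω k ∈ μ.support}

/-- The law of the i.i.d. coupling constants `(ω_k)`, `k ∈ ℤ^d`: the product measure `⊗_k μ`
(it is carried by `configurations d μ`). -/
def couplingLaw (d : ℕ) (μ : Measure ℝ) [IsProbabilityMeasure μ] : Measure (Lattice d → ℝ) :=
  Measure.infinitePi (fun _ : Lattice d => μ)

/-- The cube of radius `l` around `z` is uniformly `(m, E)`-regular for `ω`: it is
`(m, E)`-regular for every configuration that agrees with `ω` on the cube of radius `4l`. -/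
def IsUniformlyRegular {d : ℕ} (μ : Measure ℝ) (u : Lattice d → ℝ) (z : Lattice d) (l : ℕ)
    (m E : ℝ) (ω : Lattice d → ℝ) : Prop :=
  ∀ ω' ∈ configurations d μ, (∀ k ∈ box z (4 * l), ω' k = ω k) → IsRegular u z l m E ω'

/-- The event that for some energy in `I` neither of the cubes of radius `l` around `z₁` and `z₂`
is uniformly `(m, E)`-regular. -/
def badEvent {d : ℕ} (μ : Measure ℝ) (u : Lattice d → ℝ) (l : ℕ) (z₁ z₂ : Lattice d) (m : ℝ)
    (I : Set ℝ) : Set (Lattice d → ℝ) :=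
  {ω | ω ∈ configurations d μ ∧ ∃ E ∈ I,
    ¬ IsUniformlyRegular μ u z₁ l m E ω ∧ ¬ IsUniformlyRegular μ u z₂ l m E ω}

/-- The multiscale estimate `G(I, l, m, ξ)`. The bound is on the outer measure of the bad event,
so that nothing is claimed through a measurability convention. -/
def MultiscaleEstimate {d : ℕ} (μ : Measure ℝ) [IsProbabilityMeasure μ] (u : Lattice d → ℝ)
    (I : Set ℝ) (l : ℕ) (m ξ : ℝ) : Prop :=
  ∀ z₁ z₂ : Lattice d, 8 * (l : ℝ) < ‖z₁ - z₂‖ →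
    couplingLaw d μ (badEvent μ u l z₁ z₂ m I) ≤ ENNReal.ofReal ((l : ℝ) ^ (-2 * ξ))

/-- The admissible exponents of the multiscale analysis in dimension `d`. -/
structure AdmissibleParameters (d : ℕ) (ξ κ β q : ℝ) : Prop where
  two_mul_dim_lt : 2 * (d : ℝ) < ξ
  one_lt_kappa : 1 < κ
  kappa_lt : κ < 2 * ξ / (ξ + 2 * d)
  two_sub_lt_beta : 2 - κ < β
  beta_lt_one : β < 1
  q_pos : 0 < q
  q_lt_one : q < 1

/-- The length scale
`((1 - q) m₀ / ((1 - q) m₀ + m₀ + 1)) ^ (-κ / (1 - β))`, which controls the total loss of mass. -/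
def massLossScale (β κ q m₀ : ℝ) : ℝ :=
  ((1 - q) * m₀ / ((1 - q) * m₀ + m₀ + 1)) ^ (-κ / (1 - β))

/-- The (uniform) initial scale estimate in `I` with exponents `ξ, κ, β, q`; the number `lstar` is
the length scale above which the induction step of the multiscale analysis applies. -/
def InitialScaleEstimate {d : ℕ} (μ : Measure ℝ) [IsProbabilityMeasure μ] (u : Lattice d → ℝ)
    (I : Set ℝ) (lstar ξ κ β q : ℝ) : Prop :=
  AdmissibleParameters d ξ κ β q ∧
    ∃ (m₀ : ℝ) (l₀ : ℕ), 0 < m₀ ∧ 1 < l₀ ∧ lstar ≤ (l₀ : ℝ) ∧ massLossScale β κ q m₀ ≤ (l₀ : ℝ) ∧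
      (l₀ : ℝ) ^ (β - 1) < m₀ ∧ MultiscaleEstimate μ u I l₀ m₀ ξ

/-- Exponential decay of the single-site potential with constants `C` and `α`. -/
def ExponentialDecay {d : ℕ} (u : Lattice d → ℝ) (C α : ℝ) : Prop :=
  ∀ k, |u k| ≤ C * Real.exp (-α * (l1Norm k : ℝ))

/-- `u` has negative part of size `δ`, and the support of `μ` is an interval `[0, ω₊]`. -/
def SmallNegativePart {d : ℕ} (u : Lattice d → ℝ) (μ : Measure ℝ) (δ : ℝ) : Prop :=
  (∃ uPos uNeg : Lattice d → ℝ, (∀ k, 0 ≤ uPos k) ∧ (∀ k, 0 ≤ uNeg k) ∧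
      Summable uPos ∧ Summable uNeg ∧ ∑' k, uNeg k ≤ 1 ∧ ∀ k, u k = uPos k - δ * uNeg k) ∧
    ∃ ωplus : ℝ, 0 < ωplus ∧ μ.support = Set.Icc 0 ωplus

end AlloyModel

end

/-!
If every segment of `r` consecutive sites in one coordinate direction meets a site where the
potential is at least `c`, then the Dirichlet form in that direction and the potential together
dominate `c / (2 r²)`: this is a one-dimensional Poincaré inequality along the segments. Since `u`
has positive mean and is dominated by a fixed summable function, it is bounded below at some site of
a fixed finite set, so a large coupling constant makes the potential large at a translated site; the
negative part of `u` lowers it by at most `ω₊ δ`. Conjugating with `exp (η ‖· - w‖)` costs only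
`2 d η²`, so a tilt `η` of order `1 / r` is affordable, and the Combes–Thomas argument gives decay
of the Green's function with mass of order `1 / r` at all energies below a multiple of `1 / r²`.

A cube of side length of order `l` contains a segment of small coupling constants with probability
at most `(2 l + 1) ^ d * p ^ r`, where `p < 1`. For `l = r ^ N` this decays faster than any power of
`l`, while the mass is of order `l ^ (-1 / N)`, which for large `N` satisfies every lower bound
imposed on it. In particular a single one of the two cubes is irregular with small enough
probability.
-/

open MeasureTheory

noncomputable section

namespace AlloyModel

section Lattice

variable {d : ℕ}

/-- The `i`-th standard basis vector of `ℤ^d`. -/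
abbrev unitVec (i : Fin d) : Lattice d := Pi.single i 1

theorem abs_apply_le_l1Norm (k : Lattice d) (i : Fin d) : |k i| ≤ l1Norm k :=
  Finset.single_le_sum (f := fun i => |k i|) (fun _ _ => abs_nonneg _) (Finset.mem_univ i)

theorem l1Norm_neg (k : Lattice d) : l1Norm (-k) = l1Norm k := by
  simp [l1Norm]

/-- The `2d` vectors of `ℓ¹`-norm one, indexed by a coordinate and a sign. -/
def step (p : Fin d × ℤˣ) : Lattice d := Pi.single p.1 (p.2 : ℤ)

theorem step_injective : Function.Injective (step (d := d)) := by
  rintro ⟨i, a⟩ ⟨j, b⟩ h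
  obtain rfl : i = j := by
    by_contra hij
    simpa [step, hij] using congrFun h i
  simpa [step, Units.val_inj] using congrFun h i

theorem l1Norm_eq_one_iff {k : Lattice d} : l1Norm k = 1 ↔ ∃ p, step p = k := by
  constructor
  · intro hk
    obtain ⟨i, hi⟩ : ∃ i, k i ≠ 0 := by
      by_contra! h
      simp [l1Norm, h] at hk
    have hunit : IsUnit (k i) := Int.isUnit_iff_abs_eq.2 <|
      le_antisymm ((abs_apply_le_l1Norm k i).trans hk.le) (Int.one_le_abs hi)
    have hzero : ∀ j ≠ i, k j = 0 := fun j hj => by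
      have hpair : |k i| + |k j| ≤ l1Norm k :=
        Finset.add_le_sum (f := fun i => |k i|) (fun _ _ => abs_nonneg _)
          (Finset.mem_univ i) (Finset.mem_univ j) hj.symm
      rw [hk, Int.isUnit_iff_abs_eq.1 hunit] at hpair
      exact abs_nonpos_iff.1 (by omega)
    refine ⟨(i, hunit.unit), funext fun j => ?_⟩
    rcases eq_or_ne j i with rfl | hj
    · simp [step]
    · simp [step, hj, hzero j hj]
  · rintro ⟨⟨i, a⟩, rfl⟩
    have hstep : ∀ j, |step (i, a) j| = (Pi.single i 1 : Lattice d) j := fun j => by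
      rcases eq_or_ne j i with rfl | hj <;> simp [step, Int.isUnit_iff_abs_eq.1 a.isUnit, *]
    simp [l1Norm, hstep]

theorem mem_box {z x : Lattice d} {l : ℕ} : x ∈ box z l ↔ ∀ i, |x i - z i| ≤ l := by
  simp only [box, Finset.mem_Icc, Pi.le_def, abs_le, ← forall_and]
  refine forall_congr' fun i => ?_
  omega

theorem mem_box_iff_norm_sub_le {z x : Lattice d} {l : ℕ} : x ∈ box z l ↔ ‖x - z‖ ≤ l := by
  rw [mem_box, pi_norm_le_iff_of_nonneg l.cast_nonneg]
  refine forall_congr' fun i => ?_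
  rw [Pi.sub_apply, Int.norm_eq_abs]
  norm_cast

theorem card_box (z : Lattice d) (l : ℕ) : (box z l).card = (2 * l + 1) ^ d := by
  have hside : ∀ i, (z i + l + 1 - (z i - l)).toNat = 2 * l + 1 := fun i => by omega
  simp [box, Pi.card_Icc, hside]

theorem neighbors_eq_map (x : Lattice d) :
    neighbors x =
      Finset.univ.map ((⟨step, step_injective⟩ : _ ↪ _).trans (addLeftEmbedding x)) := by
  ext y
  rw [neighbors, Finset.mem_filter, ← l1Norm_neg, neg_sub, and_iff_right_of_imp]
  · simp [l1Norm_eq_one_iff, eq_sub_iff_add_eq, add_comm]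
  · exact fun hy => mem_box.2 fun i => (abs_apply_le_l1Norm (y - x) i).trans hy.le

theorem card_neighbors (x : Lattice d) : (neighbors x).card = 2 * d := by
  simp [neighbors_eq_map, mul_comm]

theorem sum_neighbors (x : Lattice d) (f : Lattice d → ℝ) :
    ∑ y ∈ neighbors x, f y = ∑ i, (f (x + unitVec i) + f (x - unitVec i)) := by
  simp [neighbors_eq_map, Fintype.sum_prod_type, step, sub_eq_add_neg, UnitsInt.univ,
    Pi.single_neg]

theorem neighbors_subset_box {z x : Lattice d} {l : ℕ} (h : ‖x - z‖ < l) :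
    neighbors x ⊆ box z l := by
  intro y hy
  refine mem_box.2 fun i => ?_
  have hx : |x i - z i| < l := by
    have := (norm_le_pi_norm (x - z) i).trans_lt h
    rw [Pi.sub_apply, Int.norm_eq_abs] at this
    exact_mod_cast this
  have hxy : |y i - x i| ≤ 1 := by
    rw [abs_sub_comm]
    exact (abs_apply_le_l1Norm (x - y) i).trans (Finset.mem_filter.1 hy).2.le
  have := abs_sub_le (y i) (x i) (z i)
  omega

theorem le_norm_sub_of_mem_innerBoundary {z w : Lattice d} {l : ℕ}
    (hw : w ∈ innerBoundary (box z l)) : (l : ℝ) ≤ ‖z - w‖ := by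
  by_contra! hlt
  have hsub : neighbors w ⊆ (box z l).filter fun y => l1Norm (w - y) = 1 := fun y hy =>
    Finset.mem_filter.2
      ⟨neighbors_subset_box (norm_sub_rev z w ▸ hlt) hy, (Finset.mem_filter.1 hy).2⟩
  have := Finset.card_le_card hsub
  rw [card_neighbors] at this
  exact (Finset.mem_filter.1 hw).2.not_ge this

end Lattice

section ShiftEnergy

theorem sq_sub_le_mul_sum_sq_sub (f : ℕ → ℝ) (n : ℕ) :
    (f n - f 0) ^ 2 ≤ n * ∑ k ∈ Finset.range n, (f (k + 1) - f k) ^ 2 := by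
  rw [← Finset.sum_range_sub]
  simpa using sq_sum_le_card_mul_sum_sq (s := Finset.range n) (f := fun k => f (k + 1) - f k)

theorem sq_le_sum_add_sum_sq_sub {f a : ℕ → ℝ} (ha : ∀ k, 0 ≤ a k) {j r : ℕ} (hj : j < r)
    (hfa : f j ^ 2 ≤ a j) :
    f 0 ^ 2 ≤ 2 * ∑ k ∈ Finset.range r, a k
      + 2 * r * ∑ k ∈ Finset.range r, (f (k + 1) - f k) ^ 2 := by
  have hend : f j ^ 2 ≤ ∑ k ∈ Finset.range r, a k :=
    hfa.trans (Finset.single_le_sum (fun k _ => ha k) (Finset.mem_range.2 hj))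
  have hpath : (f j - f 0) ^ 2 ≤ r * ∑ k ∈ Finset.range r, (f (k + 1) - f k) ^ 2 :=
    (sq_sub_le_mul_sum_sq_sub f j).trans (by gcongr)
  have hsplit : f 0 ^ 2 ≤ 2 * f j ^ 2 + 2 * (f j - f 0) ^ 2 := by
    linarith [sq_nonneg (2 * f j - f 0)]
  linarith

variable {G : Type*} [AddGroup G]

theorem summable_comp_add_right {f : G → ℝ} (hf : Summable f) (a : G) :
    Summable fun x => f (x + a) :=
  (Equiv.addRight a).summable_iff.2 hf

theorem tsum_comp_add_right (f : G → ℝ) (a : G) : ∑' x, f (x + a) = ∑' x, f x :=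
  (Equiv.addRight a).tsum_eq f

theorem tsum_sum_range_comp_add_nsmul {f : G → ℝ} (hf : Summable f) (e : G) (r : ℕ) :
    ∑' x, ∑ k ∈ Finset.range r, f (x + k • e) = r * ∑' x, f x := by
  rw [Summable.tsum_finsetSum fun k _ => summable_comp_add_right hf (k • e)]
  simp [tsum_comp_add_right]

/-- The Dirichlet form `∑ₓ (F (x + e) - F x)²` of `F` in the direction `e`. -/
def shiftEnergy (e : G) (F : G → ℝ) : ℝ := ∑' x, (F (x + e) - F x) ^ 2

theorem shiftEnergy_nonneg (e : G) (F : G → ℝ) : 0 ≤ shiftEnergy e F :=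
  tsum_nonneg fun _ => sq_nonneg _

theorem summable_sq_sub {F : G → ℝ} (hF : Summable fun x => F x ^ 2) (e : G) :
    Summable fun x => (F (x + e) - F x) ^ 2 :=
  .of_nonneg_of_le (fun _ => sq_nonneg _)
    (fun x => by linarith [sq_nonneg (F (x + e) + F x)])
    (((summable_comp_add_right hF e).add hF).mul_left 2)

theorem tsum_sq_le_add_shiftEnergy {F A : G → ℝ} (hF : Summable fun x => F x ^ 2)
    (hA : Summable A) (hA₀ : ∀ x, 0 ≤ A x) {e : G} {r : ℕ}
    (hit : ∀ x, ∃ j < r, F (x + j • e) ^ 2 ≤ A (x + j • e)) :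
    ∑' x, F x ^ 2 ≤ 2 * r * ∑' x, A x + 2 * r ^ 2 * shiftEnergy e F := by
  have hD := summable_sq_sub hF e
  have hpoint : ∀ x, F x ^ 2 ≤ 2 * ∑ k ∈ Finset.range r, A (x + k • e)
      + 2 * r * ∑ k ∈ Finset.range r, (F (x + k • e + e) - F (x + k • e)) ^ 2 := fun x => by
    obtain ⟨j, hj, hjA⟩ := hit x
    simpa [succ_nsmul, add_assoc] using sq_le_sum_add_sum_sq_sub
      (f := fun k => F (x + k • e)) (a := fun k => A (x + k • e)) (fun k => hA₀ _) hj hjA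
  have hsumA : Summable fun x => 2 * ∑ k ∈ Finset.range r, A (x + k • e) :=
    (summable_sum fun k _ => summable_comp_add_right hA (k • e)).mul_left 2
  have hsumD : Summable fun x =>
      2 * r * ∑ k ∈ Finset.range r, (F (x + k • e + e) - F (x + k • e)) ^ 2 :=
    (summable_sum fun k _ => summable_comp_add_right hD (k • e)).mul_left _
  calc ∑' x, F x ^ 2 ≤ _ := hF.tsum_le_tsum hpoint (hsumA.add hsumD)
    _ = 2 * (r * ∑' x, A x) + 2 * r * (r * shiftEnergy e F) := by
      rw [hsumA.tsum_add hsumD, tsum_mul_left, tsum_mul_left,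
        tsum_sum_range_comp_add_nsmul hA, tsum_sum_range_comp_add_nsmul hD, shiftEnergy]
    _ = _ := by ring

theorem tsum_mul_secondDifference {g : G → ℝ} (hg : g.HasFiniteSupport) (f : G → ℝ) (e : G) :
    ∑' x, g x * (2 * f x - f (x + e) - f (x - e))
      = ∑' x, (g (x + e) - g x) * (f (x + e) - f x) := by
  have hright : Summable fun x => g x * (f x - f (x + e)) :=
    summable_of_hasFiniteSupport (by fun_prop)
  have hleft : Summable fun x => g x * (f x - f (x - e)) :=
    summable_of_hasFiniteSupport (by fun_prop)
  have hshift : Summable fun x => g (x + e) * (f (x + e) - f x) := by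
    simpa using summable_comp_add_right hleft e
  calc ∑' x, g x * (2 * f x - f (x + e) - f (x - e))
      = ∑' x, g x * (f x - f (x + e)) + ∑' x, g x * (f x - f (x - e)) := by
        rw [← hright.tsum_add hleft]
        exact tsum_congr fun x => by ring
    _ = ∑' x, g x * (f x - f (x + e)) + ∑' x, g (x + e) * (f (x + e) - f x) := by
        simp [← tsum_comp_add_right (fun x => g x * (f x - f (x - e))) e]
    _ = ∑' x, (g (x + e) - g x) * (f (x + e) - f x) := by
        rw [← hright.tsum_add hshift]
        exact tsum_congr fun x => by ring

theorem sq_sub_sub_le_of_sq_sub_le {a b p q θ : ℝ} (ha : 0 ≤ a) (hb : 0 ≤ b)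
    (hθ : 0 ≤ θ) (hab : (b - a) ^ 2 ≤ θ * (b * a)) :
    (b * q - a * p) ^ 2 - θ / 2 * ((b * q) ^ 2 + (a * p) ^ 2)
      ≤ (b ^ 2 * q - a ^ 2 * p) * (q - p) := by
  have hloss : (b - a) ^ 2 * (p * q) ≤ θ / 2 * ((b * q) ^ 2 + (a * p) ^ 2) :=
    calc (b - a) ^ 2 * (p * q) ≤ (b - a) ^ 2 * |p * q| := by gcongr; exact le_abs_self _
      _ ≤ θ * (b * a) * |p * q| := by gcongr
      _ = θ * |b * q * (a * p)| := by
        rw [show b * q * (a * p) = b * a * (p * q) by ring, abs_mul (b * a),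
          abs_of_nonneg (mul_nonneg hb ha), mul_assoc]
      _ ≤ θ * (((b * q) ^ 2 + (a * p) ^ 2) / 2) := by
        gcongr
        exact abs_le.2 ⟨by linarith [sq_nonneg (b * q + a * p)],
          by linarith [sq_nonneg (b * q - a * p)]⟩
      _ = θ / 2 * ((b * q) ^ 2 + (a * p) ^ 2) := by ring
  linarith

theorem shiftEnergy_sub_le_tsum_weighted {W ψ : G → ℝ} (hψ : ψ.HasFiniteSupport)
    (hW : ∀ x, 0 ≤ W x) {e : G} {θ : ℝ} (hθ : 0 ≤ θ)
    (hWe : ∀ x, (W (x + e) - W x) ^ 2 ≤ θ * (W (x + e) * W x)) :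
    shiftEnergy e (fun x => W x * ψ x) - θ * ∑' x, (W x * ψ x) ^ 2
      ≤ ∑' x, W x ^ 2 * ψ x * (2 * ψ x - ψ (x + e) - ψ (x - e)) := by
  have hsupp : (fun x => W x ^ 2 * ψ x).HasFiniteSupport := by fun_prop
  have hF : Summable fun x => (W x * ψ x) ^ 2 :=
    summable_of_hasFiniteSupport (by fun_prop (disch := simp))
  have hFe := summable_comp_add_right hF e
  have hD := summable_sq_sub hF e
  rw [tsum_mul_secondDifference hsupp]
  calc shiftEnergy e (fun x => W x * ψ x) - θ * ∑' x, (W x * ψ x) ^ 2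
      = ∑' x, ((W (x + e) * ψ (x + e) - W x * ψ x) ^ 2
          - θ / 2 * ((W (x + e) * ψ (x + e)) ^ 2 + (W x * ψ x) ^ 2)) := by
        rw [hD.tsum_sub ((hFe.add hF).mul_left _), tsum_mul_left, hFe.tsum_add hF,
          tsum_comp_add_right fun x => (W x * ψ x) ^ 2, shiftEnergy]
        ring
    _ ≤ _ := (hD.sub ((hFe.add hF).mul_left _)).tsum_le_tsum
        (fun x => sq_sub_sub_le_of_sq_sub_le (hW x) (hW _) hθ (hWe x))
        (summable_of_hasFiniteSupport <| ((hsupp.fun_comp_of_injective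
          (add_left_injective e)).fun_sub hsupp).fun_mul_left _)

end ShiftEnergy

theorem sq_exp_sub_exp_le {s t : ℝ} (h : |s - t| ≤ 1) :
    (Real.exp s - Real.exp t) ^ 2 ≤ 2 * (s - t) ^ 2 * (Real.exp s * Real.exp t) := by
  have hcosh : Real.cosh (s - t) - 1 ≤ (s - t) ^ 2 := by
    have hsq : (s - t) ^ 2 ≤ 1 := (sq_le_one_iff_abs_le_one _).2 h
    have hexp := Real.abs_exp_sub_one_le (x := (s - t) ^ 2 / 2)
      (abs_le.2 ⟨by linarith [sq_nonneg (s - t)], by linarith⟩)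
    rw [abs_of_nonneg (by positivity : 0 ≤ (s - t) ^ 2 / 2)] at hexp
    linarith [(abs_le.1 hexp).2, Real.cosh_le_exp_half_sq (s - t)]
  calc (Real.exp s - Real.exp t) ^ 2
      = 2 * (Real.cosh (s - t) - 1) * (Real.exp s * Real.exp t) := by
        rw [Real.cosh_eq, neg_sub, Real.exp_sub, Real.exp_sub]
        field_simp
        ring
    _ ≤ _ := by gcongr

theorem mul_tsum_sq_le_shiftEnergy_add {G : Type*} [AddGroup G] {F V : G → ℝ}
    (hF : F.HasFiniteSupport) (hV : ∀ x, F x ≠ 0 → 0 ≤ V x) {e : G} {r : ℕ} (hr : 0 < r) {c : ℝ}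
    (hc₀ : 0 < c) (hc₁ : c ≤ 1) (hit : ∀ x, ∃ j < r, F (x + j • e) = 0 ∨ c ≤ V (x + j • e)) :
    c / (2 * r ^ 2) * ∑' x, F x ^ 2 ≤ shiftEnergy e F + ∑' x, V x * F x ^ 2 := by
  have hF₂ : (fun x => F x ^ 2).HasFiniteSupport := by fun_prop (disch := simp)
  have hVF : ∀ x, 0 ≤ V x * F x ^ 2 := fun x => by
    rcases eq_or_ne (F x) 0 with h | h
    · simp [h]
    · exact mul_nonneg (hV x h) (sq_nonneg _)
  have hpoincare := tsum_sq_le_add_shiftEnergy (summable_of_hasFiniteSupport hF₂)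
    ((summable_of_hasFiniteSupport (hF₂.fun_mul_right fun x => V x)).div_const c)
    (fun x => div_nonneg (hVF x) hc₀.le) (e := e) (r := r) fun x => by
      obtain ⟨j, hj, h | h⟩ := hit x
      · exact ⟨j, hj, by simp [h]⟩
      · exact ⟨j, hj, (le_div_iff₀' hc₀).2 (by gcongr)⟩
  have hr₁ : (1 : ℝ) ≤ r := by exact_mod_cast hr
  rw [tsum_div_const] at hpoincare
  calc c / (2 * r ^ 2) * ∑' x, F x ^ 2
      ≤ c / (2 * r ^ 2) * (2 * r * ((∑' x, V x * F x ^ 2) / c) + 2 * r ^ 2 * shiftEnergy e F) := by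
        gcongr
    _ = c * shiftEnergy e F + (∑' x, V x * F x ^ 2) / r := by
        field_simp
        ring
    _ ≤ shiftEnergy e F + ∑' x, V x * F x ^ 2 := by
        gcongr
        · exact mul_le_of_le_one_left (shiftEnergy_nonneg e F) hc₁
        · exact div_le_self (tsum_nonneg hVF) hr₁

section Hamiltonian

variable {d : ℕ} (u ω : Lattice d → ℝ)

theorem hamiltonian_eq_sum_secondDifference (ψ : Lattice d → ℝ) (x : Lattice d) :
    hamiltonian u ω ψ x
      = ∑ i, (2 * ψ x - ψ (x + unitVec i) - ψ (x - unitVec i)) + potential u ω x * ψ x := by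
  rw [hamiltonian, sum_neighbors]
  congr 1
  exact Finset.sum_congr rfl fun i _ => by ring

theorem sum_shiftEnergy_add_potential_le_tsum_hamiltonian {W ψ : Lattice d → ℝ}
    (hψ : ψ.HasFiniteSupport) (hW : ∀ x, 0 ≤ W x) {θ : ℝ} (hθ : 0 ≤ θ)
    (hWe : ∀ i x, (W (x + unitVec i) - W x) ^ 2 ≤ θ * (W (x + unitVec i) * W x)) :
    ∑ i, shiftEnergy (unitVec i) (fun x => W x * ψ x) + ∑' x, potential u ω x * (W x * ψ x) ^ 2
        - d * θ * ∑' x, (W x * ψ x) ^ 2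
      ≤ ∑' x, W x ^ 2 * ψ x * hamiltonian u ω ψ x := by
  have hkin : ∀ i, Summable fun x =>
      W x ^ 2 * ψ x * (2 * ψ x - ψ (x + unitVec i) - ψ (x - unitVec i)) := fun i =>
    summable_of_hasFiniteSupport (by fun_prop)
  have hpot : Summable fun x => potential u ω x * (W x * ψ x) ^ 2 :=
    summable_of_hasFiniteSupport (by fun_prop (disch := simp))
  calc _ = ∑ i, (shiftEnergy (unitVec i) (fun x => W x * ψ x) - θ * ∑' x, (W x * ψ x) ^ 2)
        + ∑' x, potential u ω x * (W x * ψ x) ^ 2 := by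
        simp only [Finset.sum_sub_distrib, Finset.sum_const, Finset.card_univ, Fintype.card_fin,
          nsmul_eq_mul]
        ring
    _ ≤ ∑ i, ∑' x, W x ^ 2 * ψ x * (2 * ψ x - ψ (x + unitVec i) - ψ (x - unitVec i))
        + ∑' x, potential u ω x * (W x * ψ x) ^ 2 := by
        gcongr with i
        exact shiftEnergy_sub_le_tsum_weighted hψ hW hθ (hWe i)
    _ = ∑' x, W x ^ 2 * ψ x * hamiltonian u ω ψ x := by
        rw [← Summable.tsum_finsetSum fun i _ => hkin i,
          ← (summable_sum fun i _ => hkin i).tsum_add hpot]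
        refine tsum_congr fun x => ?_
        rw [hamiltonian_eq_sum_secondDifference, mul_add, Finset.mul_sum]
        ring

theorem hamiltonian_sum_smul {ι : Type*} (s : Finset ι) (a : ι → ℝ) (f : ι → Lattice d → ℝ)
    (x : Lattice d) :
    hamiltonian u ω (∑ i ∈ s, a i • f i) x = ∑ i ∈ s, a i * hamiltonian u ω (f i) x := by
  simp only [hamiltonian, Finset.sum_apply, Pi.smul_apply, smul_eq_mul, mul_add,
    Finset.sum_add_distrib, Finset.mul_sum, ← Finset.sum_sub_distrib, mul_sub]
  rw [Finset.sum_comm]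
  simp only [mul_left_comm]

variable {Q : Finset (Lattice d)}

theorem extend_of_notMem (ψ : Q → ℝ) {x : Lattice d} (hx : x ∉ Q) :
    Function.extend Subtype.val ψ (0 : Lattice d → ℝ) x = 0 :=
  Function.extend_apply' _ _ _ (by simpa using hx)

theorem extend_eq_sum_smul_single (ψ : Q → ℝ) :
    Function.extend Subtype.val ψ 0 = ∑ y : Q, ψ y • Pi.single (y : Lattice d) (1 : ℝ) := by
  funext x
  by_cases hx : x ∈ Q
  · lift x to Q using hx
    simp [Pi.single_apply]
  · rw [extend_of_notMem ψ hx, Finset.sum_apply, Finset.sum_eq_zero]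
    rintro y -
    simp [show x ≠ y by rintro rfl; exact hx y.2]

theorem tsum_extend_mul (ψ : Q → ℝ) (g : Lattice d → ℝ) :
    ∑' x, Function.extend Subtype.val ψ 0 x * g x = ∑ x : Q, ψ x * g x := by
  rw [tsum_eq_sum (s := Q) fun x hx => by rw [extend_of_notMem ψ hx, zero_mul],
    ← Finset.sum_coe_sort Q]
  simp

open Matrix in
theorem boxHamiltonian_mulVec (ψ : Q → ℝ) (x : Q) :
    (boxHamiltonian u ω Q *ᵥ ψ) x = hamiltonian u ω (Function.extend Subtype.val ψ 0) x := by
  rw [extend_eq_sum_smul_single, hamiltonian_sum_smul]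
  simp only [mulVec, dotProduct, boxHamiltonian, of_apply, mul_comm]

theorem mul_tsum_sq_le_tsum_hamiltonian {W ψ : Lattice d → ℝ} (hψ : ∀ x ∉ Q, ψ x = 0)
    (hW : ∀ x, 0 ≤ W x) {θ : ℝ} (hθ : 0 ≤ θ)
    (hWe : ∀ i x, (W (x + unitVec i) - W x) ^ 2 ≤ θ * (W (x + unitVec i) * W x))
    {a c : ℝ} (hc₀ : 0 < c) (hc₁ : c ≤ 1) (ha : ∀ x ∈ Q, -a ≤ potential u ω x)
    {i : Fin d} {r : ℕ} (hr : 0 < r)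
    (hit : ∀ x ∈ Q, ∃ j < r, x + j • unitVec i ∈ Q → c - a ≤ potential u ω (x + j • unitVec i)) :
    (c / (2 * r ^ 2) - a - d * θ) * ∑' x, (W x * ψ x) ^ 2
      ≤ ∑' x, W x ^ 2 * ψ x * hamiltonian u ω ψ x := by
  have hfin : ψ.HasFiniteSupport :=
    Q.finite_toSet.subset fun x hx => by_contra fun hxQ => hx (hψ x hxQ)
  have hF : ∀ x ∉ Q, W x * ψ x = 0 := fun x hx => by rw [hψ x hx, mul_zero]
  have hhit := mul_tsum_sq_le_shiftEnergy_add (F := fun x => W x * ψ x)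
    (V := fun x => potential u ω x + a) (e := unitVec i) (by fun_prop)
    (fun x hx => by linarith [ha x (not_imp_comm.1 (hF x) hx)]) hr hc₀ hc₁ fun x => by
      by_cases hx : x ∈ Q
      · obtain ⟨j, hj, hcj⟩ := hit x hx
        exact ⟨j, hj, or_iff_not_imp_left.2 fun h => by linarith [hcj (not_imp_comm.1 (hF _) h)]⟩
      · exact ⟨0, hr, Or.inl (by simpa using hF x hx)⟩
  have hdir : shiftEnergy (unitVec i) (fun x => W x * ψ x)
      ≤ ∑ k, shiftEnergy (unitVec k) (fun x => W x * ψ x) :=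
    Finset.single_le_sum (f := fun k => shiftEnergy (unitVec k) (fun x => W x * ψ x))
      (fun _ _ => shiftEnergy_nonneg _ _) (Finset.mem_univ i)
  have hsplit : ∑' x, (potential u ω x + a) * (W x * ψ x) ^ 2
      = ∑' x, potential u ω x * (W x * ψ x) ^ 2 + a * ∑' x, (W x * ψ x) ^ 2 := by
    simp only [add_mul]
    rw [Summable.tsum_add, tsum_mul_left] <;>
      exact summable_of_hasFiniteSupport (by fun_prop (disch := simp))
  linarith [sum_shiftEnergy_add_potential_le_tsum_hamiltonian u ω hfin hW hθ hWe]

end Hamiltonian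

section CombesThomas

open Matrix

variable {ι : Type*} [Fintype ι]

/-- Coercivity with constant `γ` of the conjugated matrix `W A W⁻¹`, where `W` is a positive weight,
tested against the vectors `W ψ`. -/
def WeightedCoercive (A : Matrix ι ι ℝ) (W : ι → ℝ) (γ : ℝ) : Prop :=
  ∀ ψ : ι → ℝ, γ * ∑ x, (W x * ψ x) ^ 2 ≤ ∑ x, W x ^ 2 * ψ x * (A *ᵥ ψ) x

namespace WeightedCoercive

variable {A : Matrix ι ι ℝ} {W : ι → ℝ} {γ : ℝ}

theorem mono (hA : WeightedCoercive A W γ) {γ' : ℝ} (h : γ' ≤ γ) : WeightedCoercive A W γ' :=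
  fun ψ => (mul_le_mul_of_nonneg_right h (Finset.sum_nonneg fun _ _ => sq_nonneg _)).trans (hA ψ)

variable [DecidableEq ι]

theorem sub_smul_one (hA : WeightedCoercive A W γ) (E : ℝ) :
    WeightedCoercive (A - E • (1 : Matrix ι ι ℝ)) W (γ - E) := fun ψ => by
  have hE : ∑ x, W x ^ 2 * ψ x * (E * ψ x) = E * ∑ x, (W x * ψ x) ^ 2 := by
    rw [Finset.mul_sum]
    exact Finset.sum_congr rfl fun x _ => by ring
  simp only [sub_mulVec, smul_mulVec, one_mulVec, Pi.sub_apply, Pi.smul_apply, smul_eq_mul, mul_sub,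
    Finset.sum_sub_distrib, sub_mul, hE]
  linarith [hA ψ]

theorem isUnit (hA : WeightedCoercive A W γ) (hγ : 0 < γ) (hW : ∀ x, W x ≠ 0) : IsUnit A := by
  refine mulVec_injective_iff_isUnit.1 <| (injective_iff_map_eq_zero A.mulVecLin).2 fun ψ hψ => ?_
  have hle : γ * ∑ x, (W x * ψ x) ^ 2 ≤ 0 := by
    simpa [show A *ᵥ ψ = 0 from hψ] using hA ψ
  have hzero := (Finset.sum_eq_zero_iff_of_nonneg fun _ _ => sq_nonneg _).1 <|
    (nonpos_of_mul_nonpos_right hle hγ).antisymm (Finset.sum_nonneg fun _ _ => sq_nonneg _)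
  funext x
  simpa [hW x] using hzero x (Finset.mem_univ x)

theorem mul_abs_inv_apply_le (hA : WeightedCoercive A W γ) (hγ : 0 < γ) (hW : ∀ x, 0 < W x)
    (z w : ι) : γ * (W z * |A⁻¹ z w|) ≤ W w := by
  set φ : ι → ℝ := A⁻¹ *ᵥ Pi.single w 1 with hφ
  have hφz : φ z = A⁻¹ z w := by simp [hφ]
  have hAφ : A *ᵥ φ = Pi.single w 1 := by
    rw [hφ, mulVec_mulVec, mul_nonsing_inv _ ((isUnit_iff_isUnit_det A).1
      (hA.isUnit hγ fun x => (hW x).ne')), one_mulVec]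
  have hle : ∀ x, γ * (W x * φ x) ^ 2 ≤ W w ^ 2 * φ w := fun x =>
    calc γ * (W x * φ x) ^ 2 ≤ γ * ∑ y, (W y * φ y) ^ 2 := by
          gcongr
          exact Finset.single_le_sum (f := fun y => (W y * φ y) ^ 2) (fun _ _ => sq_nonneg _)
            (Finset.mem_univ x)
      _ ≤ ∑ y, W y ^ 2 * φ y * (A *ᵥ φ) y := hA φ
      _ = W w ^ 2 * φ w := by simp [hAφ, Pi.single_apply]
  have hdiag : γ * φ w ≤ 1 := by
    have hsq : γ * φ w * φ w ≤ 1 * φ w := by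
      refine le_of_mul_le_mul_left ?_ (pow_pos (hW w) 2)
      linarith [hle w]
    by_contra! hlt
    exact hsq.not_gt (mul_lt_mul_of_pos_right hlt (pos_of_mul_pos_right (one_pos.trans hlt) hγ.le))
  rw [← hφz]
  refine le_of_sq_le_sq ?_ (hW w).le
  calc (γ * (W z * |φ z|)) ^ 2 = γ * (γ * (W z * φ z) ^ 2) := by
        rw [mul_pow, mul_pow, sq_abs]
        ring
    _ ≤ γ * (W w ^ 2 * φ w) := mul_le_mul_of_nonneg_left (hle z) hγ.le
    _ = W w ^ 2 * (γ * φ w) := by ring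
    _ ≤ W w ^ 2 := mul_le_of_le_one_right (sq_nonneg _) hdiag

end WeightedCoercive

variable {d : ℕ} {u ω : Lattice d → ℝ}

theorem weightedCoercive_boxHamiltonian {Q : Finset (Lattice d)} {W : Lattice d → ℝ}
    (hW : ∀ x, 0 ≤ W x) {θ : ℝ} (hθ : 0 ≤ θ)
    (hWe : ∀ i x, (W (x + unitVec i) - W x) ^ 2 ≤ θ * (W (x + unitVec i) * W x))
    {a c : ℝ} (hc₀ : 0 < c) (hc₁ : c ≤ 1) (ha : ∀ x ∈ Q, -a ≤ potential u ω x)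
    {i : Fin d} {r : ℕ} (hr : 0 < r)
    (hit : ∀ x ∈ Q, ∃ j < r, x + j • unitVec i ∈ Q → c - a ≤ potential u ω (x + j • unitVec i)) :
    WeightedCoercive (boxHamiltonian u ω Q) (fun x => W x) (c / (2 * r ^ 2) - a - d * θ) := by
  intro ψ
  set φ : Lattice d → ℝ := Function.extend Subtype.val ψ 0 with hφ
  have hφψ : ∀ x : Q, φ x = ψ x := fun x => by simp [hφ]
  calc _ = (c / (2 * r ^ 2) - a - d * θ) * ∑' x, (W x * φ x) ^ 2 := by
        have hsq : ∀ x, (W x * φ x) ^ 2 = φ x * (W x ^ 2 * φ x) := fun x => by ring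
        simp_rw [hsq, hφ, tsum_extend_mul, ← hφ, ← hφψ, hsq]
    _ ≤ ∑' x, W x ^ 2 * φ x * hamiltonian u ω φ x :=
        mul_tsum_sq_le_tsum_hamiltonian u ω (fun x hx => extend_of_notMem ψ hx) hW hθ hWe hc₀ hc₁
          ha hr hit
    _ = _ := by
        have hcomm : ∀ x, W x ^ 2 * φ x * hamiltonian u ω φ x
            = φ x * (W x ^ 2 * hamiltonian u ω φ x) := fun x => by ring
        simp_rw [boxHamiltonian_mulVec, ← hφ, ← hφψ, hcomm]
        exact (tsum_extend_mul ψ _).trans (by simp_rw [← hφψ])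

theorem isRegular_of_weightedCoercive {z : Lattice d} {l : ℕ} {η γ m E : ℝ} (hη : 0 ≤ η)
    (hγ : 0 < γ)
    (hcoe : ∀ w, WeightedCoercive (boxHamiltonian u ω (box z l))
      (fun x : box z l => Real.exp (η * ‖(x : Lattice d) - w‖)) (γ + E))
    (hm : Real.exp ((m - η) * l) ≤ γ) : IsRegular u z l m E ω := by
  have hshift : ∀ w, WeightedCoercive
      (boxHamiltonian u ω (box z l) - E • (1 : Matrix (box z l) (box z l) ℝ))
      (fun x : box z l => Real.exp (η * ‖(x : Lattice d) - w‖)) γ := fun w => by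
    simpa using (hcoe w).sub_smul_one E
  refine ⟨?_, fun w hw => ?_⟩
  · rw [spectrum.notMem_iff, Algebra.algebraMap_eq_smul_one, ← neg_sub]
    exact ((hshift z).isUnit hγ fun x => (Real.exp_pos _).ne').neg
  · have hgreen := (hshift w).mul_abs_inv_apply_le hγ (fun x => Real.exp_pos _)
      ⟨z, center_mem_box z l⟩ w
    rw [sub_self, norm_zero, mul_zero, Real.exp_zero, ← mul_assoc] at hgreen
    have hweight : Real.exp (m * l) ≤ γ * Real.exp (η * ‖z - w‖) :=
      calc Real.exp (m * l) = Real.exp ((m - η) * l) * Real.exp (η * l) := by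
            rw [← Real.exp_add]
            ring_nf
        _ ≤ γ * Real.exp (η * ‖z - w‖) := by
            gcongr
            exact le_norm_sub_of_mem_innerBoundary hw
    rw [neg_mul, Real.exp_neg, ← one_div, le_div_iff₀' (Real.exp_pos _)]
    exact (mul_le_mul_of_nonneg_right hweight (abs_nonneg _)).trans hgreen

theorem isRegular_of_hit {z : Lattice d} {l : ℕ} {a c : ℝ} (hc₀ : 0 < c) (hc₁ : c ≤ 1)
    (ha : ∀ x ∈ box z l, -a ≤ potential u ω x) {i : Fin d} {r : ℕ} (hr : 0 < r)
    (hit : ∀ x ∈ box z l, ∃ j < r, x + j • unitVec i ∈ box z l →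
      c - a ≤ potential u ω (x + j • unitVec i))
    {η γ m E : ℝ} (hη₀ : 0 ≤ η) (hη₁ : η ≤ 1) (hγ : 0 < γ)
    (hgap : E + a + 2 * d * η ^ 2 + γ ≤ c / (2 * r ^ 2))
    (hm : Real.exp ((m - η) * l) ≤ γ) : IsRegular u z l m E ω := by
  refine isRegular_of_weightedCoercive hη₀ hγ (fun w => ?_) hm
  refine (weightedCoercive_boxHamiltonian (W := fun x => Real.exp (η * ‖x - w‖))
    (θ := 2 * η ^ 2) (fun x => (Real.exp_pos _).le) (by positivity) (fun k x => ?_) hc₀ hc₁ ha hr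
    hit).mono (by linarith)
  have hlip : |η * ‖x + unitVec k - w‖ - η * ‖x - w‖| ≤ η := by
    rw [← mul_sub, abs_mul, abs_of_nonneg hη₀]
    refine mul_le_of_le_one_right hη₀ ((abs_norm_sub_norm_le _ _).trans_eq ?_)
    rw [sub_sub_sub_cancel_right, add_sub_cancel_left, Pi.norm_single, norm_one]
  refine (sq_exp_sub_exp_le (hlip.trans hη₁)).trans
    (mul_le_mul_of_nonneg_right ?_ (by positivity))
  linarith [sq_le_sq.2 (hlip.trans (le_abs_self η))]

end CombesThomas

section SingleSitePotential

theorem summable_negPart {ι : Type*} {f : ι → ℝ} (hf : Summable f) : Summable fun k => (f k)⁻ :=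
  hf.abs.of_nonneg_of_le (fun _ => negPart_nonneg _) fun k => by
    rw [← posPart_add_negPart]
    exact le_add_of_nonneg_left (posPart_nonneg _)

theorem exists_finset_forall_exists_le {ι : Type*} {b : ι → ℝ} (hb : Summable b) {s : ℝ}
    (hs : 0 < s) :
    ∃ T : Finset ι, ∃ c > 0, ∀ u : ι → ℝ, (∀ k, |u k| ≤ b k) → s ≤ ∑' k, u k →
      ∃ k ∈ T, c ≤ u k := by
  obtain ⟨T, hT⟩ := (hb.hasSum.eventually_const_lt (sub_lt_self (∑' k, b k) (half_pos hs))).exists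
  refine ⟨T, s / (2 * (T.card + 1)), by positivity, fun u hu hsum => ?_⟩
  by_contra! hlt
  have hsummable : Summable u := .of_norm_bounded hb hu
  have htail : ∑' k : ((T : Set ι)ᶜ : Set ι), u k ≤ ∑' k : ((T : Set ι)ᶜ : Set ι), b k :=
    (hsummable.subtype _).tsum_le_tsum (fun k => (le_abs_self _).trans (hu k)) (hb.subtype _)
  have hhead : ∑ k ∈ T, u k ≤ s / 2 :=
    calc ∑ k ∈ T, u k ≤ T.card * (s / (2 * (T.card + 1))) := by
          rw [← nsmul_eq_mul]
          exact Finset.sum_le_card_nsmul _ _ _ fun k hk => (hlt k hk).le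
      _ ≤ (T.card + 1) * (s / (2 * (T.card + 1))) := by gcongr; linarith
      _ = s / 2 := by field_simp
  linarith [hsummable.sum_add_tsum_compl (s := T), hb.sum_add_tsum_compl (s := T)]

variable {d : ℕ}

theorem summable_exp_neg_mul_l1Norm {α : ℝ} (hα : 0 < α) :
    Summable fun k : Lattice d => Real.exp (-α * l1Norm k) := by
  have hint : Summable fun n : ℤ => Real.exp (-α * (|n| : ℤ)) := by
    have hnat : Summable fun n : ℕ => Real.exp (n * -α) :=
      Real.summable_exp_nat_mul_iff.2 (neg_lt_zero.2 hα)
    refine Summable.of_nat_of_neg (hnat.congr fun n => ?_) (hnat.congr fun n => ?_) <;>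
      simp [mul_comm]
  induction d with
  | zero => exact (hasSum_fintype _).summable
  | succ n ih =>
    rw [← (Fin.consEquiv fun _ => ℤ).summable_iff]
    refine (hint.mul_of_nonneg ih (fun _ => (Real.exp_pos _).le)
      fun _ => (Real.exp_pos _).le).congr fun p => ?_
    simp only [Function.comp_apply, Fin.consEquiv_apply, l1Norm, Fin.sum_univ_succ, Fin.cons_zero,
      Fin.cons_succ, Int.cast_add, mul_add, Real.exp_add]

theorem le_potential {u ω : Lattice d → ℝ} (hu : Summable u) {W : ℝ}
    (hω : ∀ k, ω k ∈ Set.Icc 0 W) (k₀ x : Lattice d) :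
    u k₀ * ω (x - k₀) - W * ∑' k, (u k)⁻ ≤ potential u ω x := by
  have hsum : Summable fun k => ω (x - k) * u k := by
    refine .of_norm_bounded (hu.norm.mul_left W) fun k => ?_
    rw [norm_mul, Real.norm_of_nonneg (hω _).1]
    exact mul_le_mul_of_nonneg_right (hω _).2 (norm_nonneg _)
  have hpoint : ∀ k, (Pi.single k₀ (u k₀ * ω (x - k₀)) : Lattice d → ℝ) k - W * (u k)⁻
      ≤ ω (x - k) * u k := fun k => by
    have hneg := mul_le_mul_of_nonneg_right (hω (x - k)).2 (negPart_nonneg (u k))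
    rcases eq_or_ne k k₀ with rfl | hk
    · rw [Pi.single_eq_same, mul_comm]
      linarith [mul_nonneg (hω (x - k)).1 (negPart_nonneg (u k))]
    · rw [Pi.single_eq_of_ne hk]
      linarith [mul_le_mul_of_nonneg_left (neg_le_of_neg_le (neg_le_negPart (u k))) (hω (x - k)).1]
  calc u k₀ * ω (x - k₀) - W * ∑' k, (u k)⁻
      ≤ ∑' k, ω (x - k) * u k := by
        rw [← tsum_mul_left]
        exact hasSum_le hpoint
          ((hasSum_pi_single k₀ _).sub ((summable_negPart hu).mul_left W).hasSum) hsum.hasSum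
    _ = potential u ω x := by
        simpa [potential] using (Equiv.subLeft x).tsum_eq fun k => ω k * u (x - k)

end SingleSitePotential

section LowSegments

variable {d : ℕ}

/-- The event that, for some segment of `r` consecutive sites in direction `i` starting in the cube,
all coupling constants on its translate by `-k₀` are below `t`. -/
def lowSegmentEvent (z : Lattice d) (l r : ℕ) (i : Fin d) (k₀ : Lattice d) (t : ℝ) :
    Set (Lattice d → ℝ) :=
  {ω | ∃ x ∈ box z l, ∀ j < r, ω (x + j • unitVec i - k₀) < t}

theorem couplingLaw_forall_lt (μ : Measure ℝ) [IsProbabilityMeasure μ] (S : Finset (Lattice d))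
    (t : ℝ) : couplingLaw d μ {ω | ∀ k ∈ S, ω k < t} = μ (Set.Iio t) ^ S.card := by
  have hcylinder : {ω : Lattice d → ℝ | ∀ k ∈ S, ω k < t}
      = Set.pi (S : Set (Lattice d)) fun _ => Set.Iio t := by
    ext ω
    simp
  rw [hcylinder, couplingLaw, Measure.infinitePi_pi _ fun _ _ => measurableSet_Iio,
    Finset.prod_const]

theorem couplingLaw_lowSegmentEvent_le (μ : Measure ℝ) [IsProbabilityMeasure μ]
    (z : Lattice d) (l r : ℕ) (i : Fin d) (k₀ : Lattice d) (t : ℝ) :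
    couplingLaw d μ (lowSegmentEvent z l r i k₀ t) ≤ (2 * l + 1) ^ d * μ (Set.Iio t) ^ r := by
  have hsegment : ∀ x : Lattice d,
      couplingLaw d μ {ω | ∀ j < r, ω (x + j • unitVec i - k₀) < t} = μ (Set.Iio t) ^ r :=
    fun x => by
      have hinj : Function.Injective fun j : ℕ => x + j • unitVec i - k₀ := fun j j' h => by
        simpa using congrFun h i
      simpa only [Finset.forall_mem_image, Finset.mem_range,
        Finset.card_image_of_injective _ hinj, Finset.card_range] using
        couplingLaw_forall_lt μ ((Finset.range r).image fun j => x + j • unitVec i - k₀) t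
  calc couplingLaw d μ (lowSegmentEvent z l r i k₀ t)
      = couplingLaw d μ (⋃ x ∈ box z l, {ω | ∀ j < r, ω (x + j • unitVec i - k₀) < t}) := by
        congr 1
        ext ω
        simp [lowSegmentEvent]
    _ ≤ ∑ x ∈ box z l, couplingLaw d μ {ω | ∀ j < r, ω (x + j • unitVec i - k₀) < t} :=
        measure_biUnion_finset_le _ _
    _ = (2 * l + 1) ^ d * μ (Set.Iio t) ^ r := by
        rw [Finset.sum_congr rfl fun x _ => hsegment x]
        simp [card_box]

variable {μ : Measure ℝ} {u : Lattice d → ℝ} {W c t : ℝ} {l r : ℕ} {k₀ : Lattice d} {η γ m E : ℝ}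

theorem isUniformlyRegular_of_notMem_lowSegmentEvent (hμ : μ.support ⊆ Set.Icc 0 W)
    (hu : Summable u) (hk₀ : k₀ ∈ box 0 l) (huk₀ : 0 ≤ u k₀) (hc₀ : 0 < c) (hc₁ : c ≤ 1)
    (hct : c ≤ u k₀ * t) (hr : 0 < r) (hη₀ : 0 ≤ η) (hη₁ : η ≤ 1) (hγ : 0 < γ)
    (hgap : E + W * ∑' k, (u k)⁻ + 2 * d * η ^ 2 + γ ≤ c / (2 * r ^ 2))
    (hm : Real.exp ((m - η) * l) ≤ γ) {z : Lattice d} {i : Fin d} {ω : Lattice d → ℝ}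
    (hω : ω ∉ lowSegmentEvent z l r i k₀ t) : IsUniformlyRegular μ u z l m E ω := by
  intro ω' hω' hagree
  have hcoupling : ∀ k, ω' k ∈ Set.Icc 0 W := fun k => hμ (hω' k)
  have hpot := le_potential hu hcoupling k₀
  refine isRegular_of_hit hc₀ hc₁ (fun x _ => ?_) (i := i) hr (fun x hx => ?_) hη₀ hη₁ hγ hgap hm
  · linarith [hpot x, mul_nonneg huk₀ (hcoupling (x - k₀)).1]
  · simp only [lowSegmentEvent, Set.mem_ofPred_eq, not_exists, not_and, not_forall, not_lt] at hω
    obtain ⟨j, hj, htj⟩ := hω x hx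
    refine ⟨j, hj, fun hy => ?_⟩
    have hmem : x + j • unitVec i - k₀ ∈ box z (4 * l) := by
      rw [mem_box_iff_norm_sub_le, sub_zero] at hk₀
      rw [mem_box_iff_norm_sub_le] at hy ⊢
      rw [sub_right_comm]
      refine (norm_sub_le _ _).trans ?_
      push_cast
      linarith [(Nat.cast_nonneg l : (0 : ℝ) ≤ l)]
    rw [← hagree _ hmem] at htj
    linarith [hpot (x + j • unitVec i), mul_le_mul_of_nonneg_left htj huk₀]

theorem multiscaleEstimate_Iic [IsProbabilityMeasure μ] (hμ : μ.support ⊆ Set.Icc 0 W)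
    (hu : Summable u) (hk₀ : k₀ ∈ box 0 l) (huk₀ : 0 ≤ u k₀) (hc₀ : 0 < c) (hc₁ : c ≤ 1)
    (hct : c ≤ u k₀ * t) (hr : 0 < r) (hneg : W * ∑' k, (u k)⁻ ≤ c / 8 / r ^ 2)
    (hm₀ : 0 ≤ m) (hmc : (d + 1) * m ≤ c / 8)
    (hexp : Real.exp (-(m / r * l)) ≤ c / 8 / r ^ 2) {ξ : ℝ}
    (hprob : (2 * l + 1) ^ d * μ (Set.Iio t) ^ r ≤ ENNReal.ofReal ((l : ℝ) ^ (-2 * ξ))) :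
    MultiscaleEstimate μ u (Set.Iic (c / 8 / r ^ 2)) l (m / r) ξ := by
  intro z₁ z₂ hz
  obtain ⟨i, -⟩ : ∃ i, z₁ i ≠ z₂ i := Function.ne_iff.1 fun h => by
    rw [h, sub_self, norm_zero] at hz
    exact hz.not_ge (by positivity)
  have hr₀ : (1 : ℝ) ≤ r := by exact_mod_cast hr
  have hm₁ : m ≤ 1 / 8 := by linarith [mul_nonneg d.cast_nonneg hm₀]
  -- With tilt `2 m / r`, half of the weight `exp (2 m l / r)` absorbs the resolvent bound.
  have hη : 2 * (m / r) ≤ 1 := by linarith [div_le_self hm₀ hr₀]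
  have htilt : 2 * d * (2 * (m / r)) ^ 2 ≤ c / 8 / r ^ 2 :=
    calc 2 * d * (2 * (m / r)) ^ 2 = 8 * (d * m * m) / r ^ 2 := by ring
      _ ≤ 8 * (c / 8 * (1 / 8)) / r ^ 2 := by
        gcongr
        linarith
      _ = c / 8 / r ^ 2 := by ring
  have hbudget : c / (2 * r ^ 2) = 4 * (c / 8 / r ^ 2) := by ring
  refine (measure_mono ?_).trans ((couplingLaw_lowSegmentEvent_le μ z₁ l r i k₀ t).trans hprob)
  rintro ω ⟨-, E, hE, hirregular, -⟩
  by_contra hω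
  refine hirregular <| isUniformlyRegular_of_notMem_lowSegmentEvent (η := 2 * (m / r))
    (γ := c / 8 / r ^ 2) hμ hu hk₀ huk₀ hc₀ hc₁ hct hr (by positivity) hη (by positivity)
    (by linarith [Set.mem_Iic.1 hE]) ?_ hω
  rwa [show (m / r - 2 * (m / r)) * l = -(m / r * l) by ring]

end LowSegments

section Scales

open Filter Topology
open scoped ENNReal NNReal

theorem eventually_massLossScale_le {β κ q c : ℝ} (hβ : β < 1) (hκ : 0 < κ) (hq : q < 1)
    (hc : 0 < c) {N : ℕ} (hN : κ / (1 - β) < N) :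
    ∀ᶠ r : ℕ in atTop, massLossScale β κ q (c / r) ≤ (r : ℝ) ^ N := by
  have hq₀ : 0 < 1 - q := sub_pos.2 hq
  set p := κ / (1 - β) with hp
  have hp₀ : 0 < p := div_pos hκ (sub_pos.2 hβ)
  have hgrowth : ∀ᶠ r : ℕ in atTop, (2 / ((1 - q) * c)) ^ p ≤ (r : ℝ) ^ (N - p) :=
    ((tendsto_rpow_atTop (sub_pos.2 hN)).comp tendsto_natCast_atTop_atTop).eventually_ge_atTop _
  filter_upwards [hgrowth, eventually_gt_atTop 0,
    tendsto_natCast_atTop_atTop.eventually_ge_atTop ((1 - q) * c + c)] with r hgrowth hr hlarge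
  have hr₀ : (0 : ℝ) < r := by exact_mod_cast hr
  calc massLossScale β κ q (c / r)
      = (((1 - q) * c + c + r) / ((1 - q) * c)) ^ p := by
        rw [massLossScale, neg_div, ← hp, Real.rpow_neg_eq_inv_rpow]
        congr 1
        field_simp
    _ ≤ (2 / ((1 - q) * c) * r) ^ p := by
        refine Real.rpow_le_rpow (by positivity) ?_ hp₀.le
        rw [div_mul_eq_mul_div]
        gcongr
        linarith
    _ = (2 / ((1 - q) * c)) ^ p * (r : ℝ) ^ p := Real.mul_rpow (by positivity) hr₀.le
    _ ≤ (r : ℝ) ^ (N - p) * (r : ℝ) ^ p := by gcongr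
    _ = (r : ℝ) ^ N := by rw [← Real.rpow_add hr₀, sub_add_cancel, Real.rpow_natCast]

theorem eventually_pow_rpow_lt_div {β c : ℝ} (hc : 0 < c) {N : ℕ} (hN : 1 < N * (1 - β)) :
    ∀ᶠ r : ℕ in atTop, ((r : ℝ) ^ N) ^ (β - 1) < c / r := by
  filter_upwards [eventually_gt_atTop 0, ((tendsto_rpow_neg_atTop (sub_pos.2 hN)).comp
    tendsto_natCast_atTop_atTop).eventually_lt_const hc] with r hr hlt
  have hr₀ : (0 : ℝ) < r := by exact_mod_cast hr
  rw [lt_div_iff₀ hr₀, ← Real.rpow_natCast, ← Real.rpow_mul hr₀.le, ← Real.rpow_add_one hr₀.ne']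
  rw [Function.comp_apply] at hlt
  convert hlt using 2
  ring

theorem eventually_exp_neg_div_mul_pow_le {c g : ℝ} (hc : 0 < c) (hg : 0 < g) {N : ℕ}
    (hN : 2 ≤ N) : ∀ᶠ r : ℕ in atTop, Real.exp (-(c / r * (r : ℝ) ^ N)) ≤ g / r ^ 2 := by
  filter_upwards [eventually_gt_atTop 0, ((tendsto_rpow_mul_exp_neg_mul_atTop_nhds_zero 2 c hc).comp
    tendsto_natCast_atTop_atTop).eventually_le_const hg] with r hr hle
  have hr₀ : (0 : ℝ) < r := by exact_mod_cast hr
  rw [Function.comp_apply, Real.rpow_two] at hle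
  have hlinear : c * r ≤ c / r * (r : ℝ) ^ N :=
    calc c * r = c / r * (r : ℝ) ^ 2 := by field_simp
      _ ≤ c / r * (r : ℝ) ^ N := by
        gcongr
        exact_mod_cast hr
  rw [le_div_iff₀' (by positivity)]
  refine le_trans ?_ hle
  gcongr
  linarith

theorem eventually_pow_mul_pow_le_rpow (d : ℕ) {θ : ℝ} (hθ₀ : 0 ≤ θ) (hθ₁ : θ < 1) (ξ : ℝ)
    (N : ℕ) :
    ∀ᶠ r : ℕ in atTop, (2 * (r : ℝ) ^ N + 1) ^ d * θ ^ r ≤ ((r : ℝ) ^ N) ^ (-2 * ξ) := by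
  set K := ⌈2 * ξ⌉₊
  filter_upwards [eventually_gt_atTop 0, (tendsto_pow_const_mul_const_pow_of_abs_lt_one
    (N * (d + K)) (abs_lt.2 ⟨by linarith, hθ₁⟩)).eventually_le_const
    (show (0 : ℝ) < (3 ^ d)⁻¹ by positivity)] with r hr hsmall
  have hl : (1 : ℝ) ≤ (r : ℝ) ^ N := one_le_pow₀ (by exact_mod_cast hr)
  have hl₀ : (0 : ℝ) < (r : ℝ) ^ N := one_pos.trans_le hl
  rw [neg_mul, Real.rpow_neg hl₀.le, ← one_div, le_div_iff₀ (Real.rpow_pos_of_pos hl₀ _)]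
  calc (2 * (r : ℝ) ^ N + 1) ^ d * θ ^ r * ((r : ℝ) ^ N) ^ (2 * ξ)
      ≤ (3 * (r : ℝ) ^ N) ^ d * θ ^ r * ((r : ℝ) ^ N) ^ (K : ℝ) := by
        gcongr
        · linarith
        · exact Nat.le_ceil _
    _ = 3 ^ d * ((r : ℝ) ^ (N * (d + K)) * θ ^ r) := by
        rw [Real.rpow_natCast]
        ring
    _ ≤ 3 ^ d * (3 ^ d)⁻¹ := by gcongr
    _ = 1 := mul_inv_cancel₀ (by positivity)

theorem eventually_pow_mul_pow_le_ofReal_rpow (d : ℕ) {p : ℝ≥0∞} (hp : p < 1) (ξ : ℝ) (N : ℕ) :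
    ∀ᶠ r : ℕ in atTop,
      (2 * (r : ℝ≥0∞) ^ N + 1) ^ d * p ^ r ≤ ENNReal.ofReal (((r : ℝ) ^ N) ^ (-2 * ξ)) := by
  lift p to ℝ≥0 using hp.ne_top
  filter_upwards [eventually_pow_mul_pow_le_rpow d p.2 (by exact_mod_cast hp) ξ N] with r hr
  calc (2 * (r : ℝ≥0∞) ^ N + 1) ^ d * p ^ r
      = ((2 * (r : ℝ≥0) ^ N + 1) ^ d * p ^ r : ℝ≥0) := by norm_cast
    _ = ENNReal.ofReal ((2 * (r : ℝ≥0) ^ N + 1) ^ d * p ^ r : ℝ≥0) := ENNReal.ofReal_coe_nnreal.symm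
    _ ≤ ENNReal.ofReal (((r : ℝ) ^ N) ^ (-2 * ξ)) := ENNReal.ofReal_le_ofReal (by exact_mod_cast hr)

theorem exists_scales (d : ℕ) {β κ q c g : ℝ} (hβ : β < 1) (hκ : 0 < κ) (hq : q < 1)
    (hc : 0 < c) (hg : 0 < g) {p : ℝ≥0∞} (hp : p < 1) (ξ R : ℝ) :
    ∃ r l : ℕ, 0 < r ∧ 1 < l ∧ R ≤ l ∧ massLossScale β κ q (c / r) ≤ l ∧
      (l : ℝ) ^ (β - 1) < c / r ∧ Real.exp (-(c / r * l)) ≤ g / r ^ 2 ∧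
      (2 * (l : ℝ≥0∞) + 1) ^ d * p ^ r ≤ ENNReal.ofReal ((l : ℝ) ^ (-2 * ξ)) := by
  have hβ₀ : 0 < 1 - β := sub_pos.2 hβ
  obtain ⟨N, hN⟩ := exists_nat_gt (max 2 (max (κ / (1 - β)) (1 / (1 - β))))
  simp only [max_lt_iff, div_lt_iff₀ hβ₀] at hN
  obtain ⟨hN₂, hNκ, hN₁⟩ := hN
  have hN₂ : 2 ≤ N := by exact_mod_cast hN₂.le
  have hpow : Tendsto (fun r : ℕ => r ^ N) atTop atTop := tendsto_pow_atTop (by omega)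
  obtain ⟨r, hr⟩ := ((eventually_gt_atTop 0).and <| (hpow.eventually_gt_atTop 1).and <|
    ((tendsto_natCast_atTop_atTop.comp hpow).eventually_ge_atTop R).and <|
    (eventually_massLossScale_le hβ hκ hq hc ((div_lt_iff₀ hβ₀).2 hNκ)).and <|
    (eventually_pow_rpow_lt_div hc hN₁).and <|
    (eventually_exp_neg_div_mul_pow_le hc hg hN₂).and <|
    eventually_pow_mul_pow_le_ofReal_rpow d hp ξ N).exists
  exact ⟨r, r ^ N, by simpa using hr⟩

end Scales

section Monotonicity

variable {d : ℕ} {μ : Measure ℝ} {u : Lattice d → ℝ} {δ : ℝ}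

theorem InitialScaleEstimate.mono [IsProbabilityMeasure μ] {I J : Set ℝ} {lstar ξ κ β q : ℝ}
    (h : InitialScaleEstimate μ u I lstar ξ κ β q) (hJ : J ⊆ I) :
    InitialScaleEstimate μ u J lstar ξ κ β q := by
  obtain ⟨hpar, m, l, hm, hl, hlstar, hmass, hmass', hG⟩ := h
  refine ⟨hpar, m, l, hm, hl, hlstar, hmass, hmass', fun z₁ z₂ hz => ?_⟩
  have hbad : badEvent μ u l z₁ z₂ m J ⊆ badEvent μ u l z₁ z₂ m I :=
    fun ω ⟨hω, E, hE, hirregular⟩ => ⟨hω, E, hJ hE, hirregular⟩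
  exact (measure_mono hbad).trans (hG z₁ z₂ hz)

theorem SmallNegativePart.support_eq (h : SmallNegativePart u μ δ) :
    μ.support = Set.Icc 0 (sSup μ.support) := by
  obtain ⟨-, W, hW, hsupp⟩ := h
  rw [hsupp, csSup_Icc hW.le]

theorem SmallNegativePart.tsum_negPart_le (h : SmallNegativePart u μ δ) (hδ : 0 ≤ δ) :
    ∑' k, (u k)⁻ ≤ δ := by
  obtain ⟨⟨uPos, uNeg, hPos, hNeg, -, hNegSum, hle, hu⟩, -⟩ := h
  have hpoint : ∀ k, (u k)⁻ ≤ δ * uNeg k := fun k =>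
    max_le (by rw [hu k]; linarith [hPos k]) (mul_nonneg hδ (hNeg k))
  have hsum := hNegSum.mul_left δ
  calc ∑' k, (u k)⁻ ≤ ∑' k, δ * uNeg k :=
        (hsum.of_nonneg_of_le (fun _ => negPart_nonneg _) hpoint).tsum_le_tsum hpoint hsum
    _ = δ * ∑' k, uNeg k := tsum_mul_left
    _ ≤ δ := mul_le_of_le_one_right hδ hle

end Monotonicity

end AlloyModel

end

open AlloyModel MeasureTheory

theorem proposition6p10_general (d : ℕ) {b : Lattice d → ℝ} (hb : Summable b) {s t : ℝ}
    (hs : 0 < s) (ht : 0 < t) (W : ℝ) {p : ENNReal} (hp : p < 1) {ξ κ β q : ℝ}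
    (hpar : AdmissibleParameters d ξ κ β q) (lstar : ℝ) :
    ∃ δ > 0, ∃ ε > 0, ∀ (μ : Measure ℝ) [IsProbabilityMeasure μ],
      μ.support ⊆ Set.Icc 0 W → μ (Set.Iio t) ≤ p →
      ∀ u : Lattice d → ℝ, (∀ k, |u k| ≤ b k) → s ≤ ∑' k, u k → ∑' k, (u k)⁻ ≤ δ →
        InitialScaleEstimate μ u (Set.Iic ε) lstar ξ κ β q := by
  obtain ⟨T, c₀, hc₀, hT⟩ := exists_finset_forall_exists_le hb hs
  obtain ⟨R, hR⟩ := T.finite_toSet.isBounded.exists_norm_le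
  set c := min (c₀ * t) 1
  have hc : 0 < c := lt_min (mul_pos hc₀ ht) one_pos
  obtain ⟨r, l, hr, hl, hRl, hmass, hmass', hexp, hprob⟩ := exists_scales d hpar.beta_lt_one
    (one_pos.trans hpar.one_lt_kappa) hpar.q_lt_one (show 0 < c / 8 / (d + 1) by positivity)
    (show 0 < c / 8 by positivity) hp ξ (max lstar R)
  obtain ⟨hlstar, hR'⟩ := max_le_iff.1 hRl
  refine ⟨c / 8 / r ^ 2 / (|W| + 1), by positivity, c / 8 / r ^ 2, by positivity,
    fun μ _ hμ hμt u hub hus huneg =>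
      ⟨hpar, c / 8 / (d + 1) / r, l, by positivity, hl, hlstar, hmass, hmass', ?_⟩⟩
  obtain ⟨k₀, hk₀, huk₀⟩ := hT u hub hus
  have hbox : k₀ ∈ box 0 l := mem_box_iff_norm_sub_le.2 (by simpa using (hR k₀ hk₀).trans hR')
  have hneg : W * ∑' k, (u k)⁻ ≤ c / 8 / r ^ 2 :=
    calc W * ∑' k, (u k)⁻ ≤ (|W| + 1) * (c / 8 / r ^ 2 / (|W| + 1)) :=
          mul_le_mul (by linarith [le_abs_self W]) huneg (tsum_nonneg fun _ => negPart_nonneg _)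
            (by positivity)
      _ = c / 8 / r ^ 2 := mul_div_cancel₀ _ (by positivity)
  exact multiscaleEstimate_Iic hμ (.of_norm_bounded hb hub) hbox (hc₀.le.trans huk₀) hc
    (min_le_right _ _) ((min_le_left _ _).trans (by gcongr)) hr hneg (by positivity)
    (by field_simp; rfl) hexp (le_trans (by gcongr) hprob)

theorem proposition6p10 (d : ℕ) (hd : 1 ≤ d)
    (μ : MeasureTheory.Measure ℝ) [MeasureTheory.IsProbabilityMeasure μ]
    (ε₀ : ℝ) (hε₀ : 0 < ε₀)
    (hμ : AlloyModel.couplingLaw d μ {ω | ω 0 < ε₀} ≤ 1 / 12)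
    (C α uMean : ℝ) (hC : 0 < C) (hα : 0 < α) (huMean : 0 < uMean)
    (ξ κ β q ζ : ℝ) (hpar : AlloyModel.AdmissibleParameters d ξ κ β q)
    (hζ : ζ ∈ Set.Ioo (2 - 2 * (1 - β) / κ) 2)
    (lstar : ℝ) :
    ∃ δ > 0, ∃ ε > 0, ∀ u : AlloyModel.Lattice d → ℝ,
      AlloyModel.ExponentialDecay u C α → ∑' k, u k = uMean →
      AlloyModel.SmallNegativePart u μ δ →
      AlloyModel.InitialScaleEstimate μ u (Set.Icc (-ε / 2) (ε / 2)) lstar ξ κ β q := by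
  have hμ' : μ (Set.Iio ε₀) ≤ 1 / 12 := by
    have hcoupling := couplingLaw_forall_lt μ ({0} : Finset (Lattice d)) ε₀
    simp only [Finset.mem_singleton, forall_eq, Finset.card_singleton, pow_one] at hcoupling
    exact hcoupling.ge.trans hμ
  obtain ⟨δ, hδ, ε, hε, h⟩ := proposition6p10_general d
    ((summable_exp_neg_mul_l1Norm hα).mul_left C) huMean hε₀ (sSup μ.support)
    (show (1 / 12 : ENNReal) < 1 by norm_num) hpar lstar
  exact ⟨δ, hδ, ε, hε, fun u hdecay hsum hneg =>
    (h μ hneg.support_eq.subset hμ' u hdecay hsum.ge (hneg.tsum_negPart_le hδ.le)).mono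
      fun E hE => hE.2.trans (half_le_self hε.le)⟩
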